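/- There is a universal constant $c > 0$ such that the following holds for all positive integers $n, d, s$ with $s \le d$, every $\sigma > 0$ and every nonzero matrix $X \in \mathbb{R}^{n \times d}$. For $\theta \in \mathbb{R}^d$ let $\|\theta\|_0$ be the number of nonzero entries of $\theta$, and let $P_\theta = \mathsf{N}(X\theta, \sigma^2 I_{n\times n})$ be the law of $Y = X\theta + \varepsilon$, where $\varepsilon \in \mathbb{R}^n$ has i.i.d. $\mathsf{N}(0,\sigma^2)$ entries. Then $$\inf_{\hat\theta}\ \sup_{\theta \in \mathbb{R}^d,\ \|\theta\|_0 \le s} \mathbb{E}_{Y \sim P_\theta}\left[\|\hat\theta(Y) - \theta\|_2^2\right] \;\ge\; c\,\frac{\sigma^2\, s\, d\, \log(d/s)}{\|X\|_F^2},$$ where the infimum is over all measurable functions $\hat\theta : \mathbb{R}^n \to \mathbb{R}^d$ (which may depend on the fixed matrix $X$), the left-hand side takes values in $[0,\infty]$, and $\|X\|_F$ is the Frobenius norm of $X$. -/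

import Mathlib

open MeasureTheory ProbabilityTheory
open scoped NNReal ENNReal Matrix Matrix.Norms.Frobenius

/-- The minimax risk `inf_{θhat} sup_i E_{P i}[ℓ (θhat, θ i)]` of a family of distributions
`P i` on a sample space `𝓧`, with parameters `θ i`, for the loss `ℓ`. The infimum is over all
measurable functions of the observation, with values in the whole parameter space `Θ`.
Expectations of the nonnegative loss take values in `[0, ∞]`. -/
noncomputable def minimaxRiskOf {ι 𝓧 Θ : Type*} [MeasurableSpace 𝓧] [MeasurableSpace Θ]
    (P : ι → Measure 𝓧) (θ : ι → Θ) (ℓ : Θ → Θ → ℝ≥0∞) : ℝ≥0∞ :=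
  ⨅ (θhat : 𝓧 → Θ) (_ : Measurable θhat), ⨆ i, ∫⁻ x, ℓ (θhat x) (θ i) ∂(P i)

/-- The squared Euclidean loss `‖u - v‖₂²` on `ℝ^d`. -/
noncomputable def sqL2Loss {d : ℕ} (u v : EuclideanSpace ℝ (Fin d)) : ℝ≥0∞ :=
  ENNReal.ofReal (‖u - v‖ ^ 2)

/-- The number `‖θ‖₀` of nonzero entries of a vector. -/
noncomputable def l0 {d : ℕ} (θ : EuclideanSpace ℝ (Fin d)) : ℕ :=
  {j : Fin d | θ j ≠ 0}.ncard

/-- The `s`-sparse vectors of `ℝ^d`. -/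
abbrev SparseVec (d s : ℕ) : Type := {θ : EuclideanSpace ℝ (Fin d) // l0 θ ≤ s}

/-- The law `N(X θ, σ² I)` of `Y = X θ + ε` on `ℝ^n`, where the entries of `ε` are i.i.d.
`N(0, σ²)`: the product of the one-dimensional laws `N((X θ) i, σ²)`. -/
noncomputable def regressionLaw {n d : ℕ} (X : Matrix (Fin n) (Fin d) ℝ) (σ : ℝ≥0)
    (θ : EuclideanSpace ℝ (Fin d)) : Measure (Fin n → ℝ) :=
  Measure.pi fun i => gaussianReal ((X *ᵥ θ.ofLp) i) (σ ^ 2)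

/-- The minimax risk, in squared Euclidean norm, of estimating `θ` over the family of laws
`N(X θ, σ² I)`, `‖θ‖₀ ≤ s`, for a fixed design matrix `X`. -/
noncomputable def sparseRegressionMinimaxRisk {n d : ℕ} (X : Matrix (Fin n) (Fin d) ℝ)
    (σ : ℝ≥0) (s : ℕ) : ℝ≥0∞ :=
  minimaxRiskOf (fun θ : SparseVec d s => regressionLaw X σ θ.1) (fun θ => θ.1) sqL2Loss

/-! Bayes bound with a product prior. More than 3/4 of the columns of X have squared norm at most
4‖X‖_F²/d. About s/3 disjoint blocks of m such columns are formed, and θ takes the value a at one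
uniformly chosen position per block. Even if all other blocks are revealed, locating the position in
one block is a test among m Gaussian shifts, each with χ² divergence at most m^(1/16) - 1 from a
common law; it fails with average probability at least 1/4 (`sum_isoGaussian_add_real_le`). A
failure costs a²/2 (`sum_ite_le_sq_norm_sub_blockVec`), and a² can be of order σ² d log m / ‖X‖_F².
-/

/-! ### Likelihood ratios of one-dimensional Gaussian shifts. -/

/-- The likelihood ratio `dN(μ + v, V) / dN(μ, V)`. -/
noncomputable def gaussianShiftRatio (V : ℝ≥0) (μ v x : ℝ) : ℝ :=
  Real.exp (v / V * x + (-(v * μ / V) - v ^ 2 / (2 * V)))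

lemma gaussianShiftRatio_nonneg (V : ℝ≥0) (μ v x : ℝ) : 0 ≤ gaussianShiftRatio V μ v x :=
  (Real.exp_pos _).le

lemma continuous_gaussianShiftRatio (V : ℝ≥0) (μ v : ℝ) :
    Continuous (gaussianShiftRatio V μ v) := by
  unfold gaussianShiftRatio; fun_prop

lemma integrable_gaussianShiftRatio (V : ℝ≥0) (μ v : ℝ) :
    Integrable (gaussianShiftRatio V μ v) (gaussianReal μ V) := by
  unfold gaussianShiftRatio
  simp_rw [Real.exp_add]
  exact (integrable_exp_mul_gaussianReal _).mul_const _

lemma gaussianReal_add_eq_withDensity {V : ℝ≥0} (hV : V ≠ 0) (μ v : ℝ) :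
    gaussianReal (μ + v) V =
      (gaussianReal μ V).withDensity fun x => ENNReal.ofReal (gaussianShiftRatio V μ v x) := by
  have hV' : (V : ℝ) ≠ 0 := by exact_mod_cast hV
  have hm : Measurable fun x => ENNReal.ofReal (gaussianShiftRatio V μ v x) :=
    (continuous_gaussianShiftRatio V μ v).measurable.ennreal_ofReal
  rw [gaussianReal_of_var_ne_zero _ hV, gaussianReal_of_var_ne_zero _ hV,
    ← withDensity_mul _ (measurable_gaussianPDF μ V) hm]
  congr 1
  ext x
  rw [Pi.mul_apply, gaussianPDF, gaussianPDF, ← ENNReal.ofReal_mul (gaussianPDFReal_nonneg _ _ _)]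
  congr 1
  rw [gaussianPDFReal, gaussianPDFReal, gaussianShiftRatio, mul_assoc (√(2 * Real.pi * V))⁻¹, ← Real.exp_add]
  congr 2
  field_simp
  ring

/-- The square is again the exponential of an affine function of x, so its mean is a value of the
Gaussian moment generating function. -/
lemma sq_gaussianShiftRatio (V : ℝ≥0) (μ v x : ℝ) :
    gaussianShiftRatio V μ v x ^ 2 =
      Real.exp (2 * v / V * x) * Real.exp (-(2 * v * μ / V) - v ^ 2 / V) := by
  rw [gaussianShiftRatio, ← Real.exp_nat_mul, ← Real.exp_add]
  congr 1
  push_cast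
  rcases eq_or_ne (V : ℝ) 0 with h | h
  · simp [h]
  · field_simp

lemma integrable_sq_gaussianShiftRatio (V : ℝ≥0) (μ v : ℝ) :
    Integrable (fun x => gaussianShiftRatio V μ v x ^ 2) (gaussianReal μ V) := by
  simp_rw [sq_gaussianShiftRatio]
  exact (integrable_exp_mul_gaussianReal _).mul_const _

lemma integral_sq_gaussianShiftRatio {V : ℝ≥0} (hV : V ≠ 0) (μ v : ℝ) :
    ∫ x, gaussianShiftRatio V μ v x ^ 2 ∂(gaussianReal μ V) = Real.exp (v ^ 2 / V) := by
  have hV' : (V : ℝ) ≠ 0 := by exact_mod_cast hV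
  have h := congrFun (mgf_id_gaussianReal (μ := μ) (v := V)) (2 * v / V)
  simp only [mgf, id] at h
  simp_rw [sq_gaussianShiftRatio]
  rw [integral_mul_const, h, ← Real.exp_add]
  congr 1
  field_simp
  ring

/-! ### Isotropic Gaussian vectors and their χ² divergence. -/

/-- The law of a Gaussian vector with independent entries of variance `V`. -/
noncomputable def isoGaussian {ι : Type*} [Fintype ι] (V : ℝ≥0) (μ : ι → ℝ) : Measure (ι → ℝ) :=
  Measure.pi fun i => gaussianReal (μ i) V

instance {ι : Type*} [Fintype ι] (V : ℝ≥0) (μ : ι → ℝ) :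
    IsProbabilityMeasure (isoGaussian V μ) := by
  unfold isoGaussian; infer_instance

/-- The likelihood ratio `dN(μ + v, V I) / dN(μ, V I)`. -/
noncomputable def isoGaussianShiftRatio {ι : Type*} [Fintype ι] (V : ℝ≥0) (μ v y : ι → ℝ) : ℝ :=
  ∏ i, gaussianShiftRatio V (μ i) (v i) (y i)

section Vector

variable {ι : Type*} [Fintype ι] (V : ℝ≥0) (μ v : ι → ℝ)

lemma isoGaussianShiftRatio_nonneg (y : ι → ℝ) : 0 ≤ isoGaussianShiftRatio V μ v y :=
  Finset.prod_nonneg fun _ _ => gaussianShiftRatio_nonneg _ _ _ _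

lemma continuous_isoGaussianShiftRatio : Continuous (isoGaussianShiftRatio V μ v) :=
  continuous_finsetProd _ fun i _ =>
    (continuous_gaussianShiftRatio V (μ i) (v i)).comp (continuous_apply i)

lemma integrable_isoGaussianShiftRatio :
    Integrable (isoGaussianShiftRatio V μ v) (isoGaussian V μ) :=
  Integrable.fintype_prod fun i => integrable_gaussianShiftRatio V (μ i) (v i)

lemma integrable_sq_isoGaussianShiftRatio :
    Integrable (fun y => isoGaussianShiftRatio V μ v y ^ 2) (isoGaussian V μ) := by
  simp_rw [isoGaussianShiftRatio, ← Finset.prod_pow]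
  exact Integrable.fintype_prod (f := fun i x => gaussianShiftRatio V (μ i) (v i) x ^ 2)
    fun i => integrable_sq_gaussianShiftRatio V (μ i) (v i)

variable {V}

lemma integral_sq_isoGaussianShiftRatio (hV : V ≠ 0) :
    ∫ y, isoGaussianShiftRatio V μ v y ^ 2 ∂(isoGaussian V μ) =
      Real.exp ((∑ i, v i ^ 2) / V) := by
  simp_rw [isoGaussianShiftRatio, ← Finset.prod_pow, isoGaussian]
  rw [integral_fintype_prod_eq_prod (f := fun i x => gaussianShiftRatio V (μ i) (v i) x ^ 2)]
  simp_rw [integral_sq_gaussianShiftRatio hV]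
  rw [← Real.exp_sum, Finset.sum_div]

/-- A product measure is determined by boxes, and on a box the integral of the product ratio
factorizes. -/
lemma isoGaussian_add_eq_withDensity (hV : V ≠ 0) :
    isoGaussian V (μ + v) =
      (isoGaussian V μ).withDensity fun y => ENNReal.ofReal (isoGaussianShiftRatio V μ v y) := by
  refine Measure.pi_eq fun s hs => ?_
  rw [withDensity_apply _ (MeasurableSet.univ_pi hs), isoGaussian, Measure.restrict_pi_pi,
    ← ofReal_integral_eq_lintegral_ofReal]
  · unfold isoGaussianShiftRatio
    rw [integral_fintype_prod_eq_prod (f := fun i x => gaussianShiftRatio V (μ i) (v i) x),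
      ENNReal.ofReal_prod_of_nonneg fun i _ =>
        integral_nonneg fun x => gaussianShiftRatio_nonneg _ _ _ _]
    refine Finset.prod_congr rfl fun i _ => ?_
    rw [Pi.add_apply, gaussianReal_add_eq_withDensity hV, withDensity_apply _ (hs i),
      ofReal_integral_eq_lintegral_ofReal (integrable_gaussianShiftRatio _ _ _).restrict
        (ae_of_all _ fun x => gaussianShiftRatio_nonneg _ _ _ _)]
  · exact Integrable.fintype_prod fun i =>
      (integrable_gaussianShiftRatio V (μ i) (v i)).restrict
  · exact ae_of_all _ fun y => isoGaussianShiftRatio_nonneg _ _ _ _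

lemma isoGaussian_add_real_apply (hV : V ≠ 0) {A : Set (ι → ℝ)} (hA : MeasurableSet A) :
    (isoGaussian V (μ + v)).real A = ∫ y in A, isoGaussianShiftRatio V μ v y ∂(isoGaussian V μ) := by
  rw [measureReal_def, isoGaussian_add_eq_withDensity μ v hV, withDensity_apply _ hA,
    integral_eq_lintegral_of_nonneg_ae
      (ae_of_all _ fun y => isoGaussianShiftRatio_nonneg _ _ _ _)
      (continuous_isoGaussianShiftRatio V μ v).aestronglyMeasurable]

/-- A `χ²` change-of-measure bound for a shift of an isotropic Gaussian vector. -/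
lemma isoGaussian_add_real_le (hV : V ≠ 0) {A : Set (ι → ℝ)} (hA : MeasurableSet A) {t : ℝ}
    (ht : 0 < t) :
    (isoGaussian V (μ + v)).real A ≤ (isoGaussian V μ).real A +
      (t * (Real.exp ((∑ i, v i ^ 2) / V) - 1) + (isoGaussian V μ).real A / t) / 2 := by
  set Q := isoGaussian V μ
  set L := isoGaussianShiftRatio V μ v
  have hL : Integrable L Q := integrable_isoGaussianShiftRatio V μ v
  have hL2 : Integrable (fun y => L y ^ 2) Q := integrable_sq_isoGaussianShiftRatio V μ v
  have h1 : ∫ y, L y ∂Q = 1 := by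
    have := isoGaussian_add_real_apply μ v hV MeasurableSet.univ
    rw [setIntegral_univ] at this
    simpa using this.symm
  have h2 : ∫ y, L y ^ 2 ∂Q = Real.exp ((∑ i, v i ^ 2) / V) :=
    integral_sq_isoGaussianShiftRatio μ v hV
  have hI : Integrable (fun y => (L y - 1) ^ 2) Q := by
    have : (fun y => (L y - 1) ^ 2) = fun y => (L y ^ 2 - 2 * L y) + 1 := by
      ext y; ring
    rw [this]
    exact (hL2.sub (hL.const_mul 2)).add (integrable_const 1)
  have h3 : ∫ y, (L y - 1) ^ 2 ∂Q = Real.exp ((∑ i, v i ^ 2) / V) - 1 := by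
    have : (fun y => (L y - 1) ^ 2) = fun y => (L y ^ 2 - 2 * L y) + 1 := by
      ext y; ring
    rw [this, integral_add (f := fun y => L y ^ 2 - 2 * L y) (hL2.sub (hL.const_mul 2))
        (integrable_const 1), integral_sub hL2 (hL.const_mul 2), integral_const_mul, h1, h2]
    simp
    ring
  calc (isoGaussian V (μ + v)).real A = ∫ y in A, L y ∂Q := isoGaussian_add_real_apply μ v hV hA
    -- Weighted AM-GM for L - 1. Unlike Cauchy-Schwarz, it gives a bound linear in Q(A), which can
    -- be summed over disjoint sets.
    _ ≤ ∫ y in A, (t / 2 * (L y - 1) ^ 2 + (1 + 1 / (2 * t))) ∂Q := by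
        refine integral_mono hL.restrict
          (((hI.const_mul _).add (integrable_const _)).restrict) fun y => ?_
        have : t / 2 * (L y - 1) ^ 2 + (1 + 1 / (2 * t)) - L y =
            (t * (L y - 1) - 1) ^ 2 / (2 * t) := by
          field_simp
          ring
        have h0 : 0 ≤ (t * (L y - 1) - 1) ^ 2 / (2 * t) := by positivity
        show L y ≤ t / 2 * (L y - 1) ^ 2 + (1 + 1 / (2 * t))
        linarith
    _ = t / 2 * ∫ y in A, (L y - 1) ^ 2 ∂Q + Q.real A * (1 + 1 / (2 * t)) := by
        rw [integral_add (hI.const_mul _).restrict (integrable_const _).restrict,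
          integral_const_mul]
        simp
    _ ≤ t / 2 * ∫ y, (L y - 1) ^ 2 ∂Q + Q.real A * (1 + 1 / (2 * t)) := by
        have := setIntegral_le_integral (s := A) hI (ae_of_all _ fun y => sq_nonneg (L y - 1))
        gcongr
    _ = _ := by
        rw [h3]
        field_simp
        ring

end Vector

/-! ### Testing among many weak shifts. -/

/-- Among `m ≥ 2` weak shifts of an isotropic Gaussian vector, no test identifies the shift with
average success probability above `3 / 4`. -/
lemma sum_isoGaussian_add_real_le {ι : Type*} [Fintype ι] {V : ℝ≥0} (hV : V ≠ 0) {m : ℕ}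
    (hm : 2 ≤ m) (μ : ι → ℝ) (v : Fin m → ι → ℝ)
    (hv : ∀ j, (∑ i, v j i ^ 2) / V ≤ Real.log m / 16) (A : Fin m → Set (ι → ℝ))
    (hA : ∀ j, MeasurableSet (A j)) (hdis : Pairwise (Function.onFun Disjoint A)) :
    ∑ j, (isoGaussian V (μ + v j)).real (A j) ≤ 3 / 4 * m := by
  have hm' : (2 : ℝ) ≤ m := by exact_mod_cast hm
  have hexp (j : Fin m) : Real.exp ((∑ i, v j i ^ 2) / V) - 1 ≤ (m - 1 : ℝ) / 16 := by
    have h1 : Real.exp ((∑ i, v j i ^ 2) / V) ≤ (m : ℝ) ^ (1 / 16 : ℝ) := by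
      rw [Real.rpow_def_of_pos (by linarith)]
      exact Real.exp_le_exp.2 ((hv j).trans (by linarith))
    -- Bernoulli's inequality for the concave power 1/16.
    have h2 := rpow_one_add_le_one_add_mul_self (s := (m : ℝ) - 1) (by linarith)
      (p := 1 / 16) (by norm_num) (by norm_num)
    rw [add_sub_cancel] at h2
    linarith
  have hQ : ∑ j, (isoGaussian V μ).real (A j) ≤ 1 := by
    rw [← measureReal_iUnion_fintype hdis hA]
    exact measureReal_le_one
  have hj (j : Fin m) : (isoGaussian V (μ + v j)).real (A j) ≤
      (1 + m / 8) * (isoGaussian V μ).real (A j) + (m - 1 : ℝ) / 16 * (2 / m) := by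
    -- With t = 4/m the sum over j is at most 7/8 + m/4, hence at most 3m/4 since m ≥ 2.
    have h := isoGaussian_add_real_le μ (v j) hV (hA j) (t := 4 / m) (by positivity)
    have h' : 4 / (m : ℝ) * (Real.exp ((∑ i, v j i ^ 2) / V) - 1) ≤
        4 / m * ((m - 1 : ℝ) / 16) := by
      gcongr
      exact hexp j
    have e : (isoGaussian V μ).real (A j) / (4 / m) = m / 4 * (isoGaussian V μ).real (A j) := by
      field_simp
    rw [e] at h
    have e2 : (m - 1 : ℝ) / 16 * (2 / m) = 4 / m * ((m - 1 : ℝ) / 16) / 2 := by ring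
    linarith
  calc ∑ j, (isoGaussian V (μ + v j)).real (A j)
      ≤ ∑ j, ((1 + m / 8) * (isoGaussian V μ).real (A j) + (m - 1 : ℝ) / 16 * (2 / m)) :=
        Finset.sum_le_sum fun j _ => hj j
    _ = (1 + m / 8) * ∑ j, (isoGaussian V μ).real (A j) + (m - 1) / 8 := by
        rw [Finset.sum_add_distrib, ← Finset.mul_sum]
        simp
        field_simp
        ring
    _ ≤ (1 + m / 8) * 1 + (m - 1) / 8 := by gcongr
    _ ≤ 3 / 4 * m := by linarith

lemma sum_le_sum_of_funSplitAt {κ α : Type*} [Fintype κ] [DecidableEq κ] [Fintype α] (k : κ)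
    (F : (κ → α) → ℝ) {c : ℝ}
    (h : ∀ g, ∑ j, F ((Equiv.funSplitAt k α).symm (j, g)) ≤ ∑ _j : α, c) :
    ∑ f, F f ≤ ∑ _f : κ → α, c := by
  rw [← (Equiv.funSplitAt k α).symm.sum_comp F,
    ← (Equiv.funSplitAt k α).symm.sum_comp fun _ => c, Fintype.sum_prod_type_right,
    Fintype.sum_prod_type_right]
  exact Finset.sum_le_sum fun g _ => h g

/-- Averaged over a product prior with one of `m` weak shifts in each block, no family of tests
identifies the shifts with success probability above `3 / 4`. -/
lemma sum_sum_isoGaussian_real_le {ι κ : Type*} [Fintype ι] [Fintype κ] [DecidableEq κ]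
    {V : ℝ≥0} (hV : V ≠ 0) {m : ℕ} (hm : 2 ≤ m) (w : κ → Fin m → ι → ℝ)
    (hw : ∀ k j, (∑ i, w k j i ^ 2) / V ≤ Real.log m / 16) (A : κ → Fin m → Set (ι → ℝ))
    (hA : ∀ k j, MeasurableSet (A k j))
    (hdis : ∀ k, Pairwise (Function.onFun Disjoint (A k))) :
    ∑ f : κ → Fin m, ∑ k, (isoGaussian V (∑ k', w k' (f k'))).real (A k (f k)) ≤
      ∑ _f : κ → Fin m, 3 / 4 * (Fintype.card κ : ℝ) := by
  have key (k : κ) : ∑ f : κ → Fin m, (isoGaussian V (∑ k', w k' (f k'))).real (A k (f k)) ≤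
      ∑ _f : κ → Fin m, (3 / 4 : ℝ) := by
    -- With the choices g in the other blocks frozen, their total shift is the common mean.
    refine sum_le_sum_of_funSplitAt k _ fun g => ?_
    refine (Finset.sum_congr rfl fun j _ => ?_).trans_le
      ((sum_isoGaussian_add_real_le hV hm (∑ k' : {k' // k' ≠ k}, w k' (g k')) (w k) (hw k) (A k)
        (hA k) (hdis k)).trans (le_of_eq ?_))
    · have h1 : (Equiv.funSplitAt k (Fin m)).symm (j, g) k = j := by simp
      have h2 (k' : {k' // k' ≠ k}) : (Equiv.funSplitAt k (Fin m)).symm (j, g) k' = g k' := by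
        simp [k'.2]
      rw [Fintype.sum_eq_add_sum_subtype_ne _ k, add_comm, h1]
      simp_rw [h2]
    · simp [mul_comm]
  rw [Finset.sum_comm]
  refine (Finset.sum_le_sum fun k _ => key k).trans (le_of_eq ?_)
  simp
  ring

/-! ### The sparse prior and its loss. -/

/-- The vector with entry `a` at one chosen position `e (k, f k)` of each block `k`. -/
noncomputable def blockVec {d m : ℕ} {κ : Type*} [Fintype κ] (e : κ × Fin m ↪ Fin d) (a : ℝ)
    (f : κ → Fin m) : EuclideanSpace ℝ (Fin d) :=
  WithLp.toLp 2 (∑ k, Pi.single (e (k, f k)) a)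

section BlockVec

variable {n d m : ℕ} {κ : Type*} [Fintype κ] (e : κ × Fin m ↪ Fin d) (a : ℝ) (f : κ → Fin m)

lemma blockVec_apply [DecidableEq κ] (k : κ) (j : Fin m) :
    blockVec e a f (e (k, j)) = if j = f k then a else 0 := by
  simp only [blockVec, Finset.sum_apply, Pi.single_apply, e.injective.eq_iff, Prod.mk.injEq]
  rw [Finset.sum_eq_single k]
  · simp
  · intro k' _ hk'
    simp [hk'.symm]
  · simp

lemma l0_blockVec_le : l0 (blockVec e a f) ≤ Fintype.card κ := by
  have hsub : {i : Fin d | blockVec e a f i ≠ 0} ⊆ Set.range fun k => e (k, f k) := by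
    intro i hi
    by_contra h
    refine hi ?_
    simp only [blockVec, Finset.sum_apply, Pi.single_apply]
    exact Finset.sum_eq_zero fun k _ => if_neg fun h' => h ⟨k, h'.symm⟩
  calc l0 (blockVec e a f) ≤ (Set.range fun k => e (k, f k)).ncard :=
        Set.ncard_le_ncard hsub (Set.toFinite _)
    _ ≤ Fintype.card κ := by
        rw [← Set.image_univ, ← Nat.card_eq_fintype_card, ← Set.ncard_univ]
        exact Set.ncard_image_le

lemma mulVec_blockVec (X : Matrix (Fin n) (Fin d) ℝ) :
    X *ᵥ (blockVec e a f).ofLp = ∑ k, fun i => a * X i (e (k, f k)) := by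
  rw [blockVec, Matrix.mulVec_sum]
  refine Finset.sum_congr rfl fun k _ => ?_
  ext i
  simp [Matrix.mulVec_single, mul_comm]

/-- An estimator that does not rank the true position first within a block incurs a loss of at
least `a² / 2` on this block. -/
lemma sum_ite_le_sq_norm_sub_blockVec [DecidableEq κ] (ha : 0 ≤ a)
    (u : EuclideanSpace ℝ (Fin d)) :
    ∑ k, (if ∀ j, j ≠ f k → u (e (k, j)) < u (e (k, f k)) then 0 else a ^ 2 / 2) ≤
      ‖u - blockVec e a f‖ ^ 2 := by
  have hblock (k : κ) : (if ∀ j, j ≠ f k → u (e (k, j)) < u (e (k, f k)) then 0 else a ^ 2 / 2) ≤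
      ∑ j, (u (e (k, j)) - if j = f k then a else 0) ^ 2 := by
    split_ifs with h
    · exact Finset.sum_nonneg fun _ _ => sq_nonneg _
    · push Not at h
      obtain ⟨j, hj, hle⟩ := h
      -- Two coordinates suffice: (x - a)² + y² ≥ a²/2 whenever x ≤ y.
      have h2 : ∑ j' ∈ {f k, j}, (u (e (k, j')) - if j' = f k then a else 0) ^ 2 ≤
          ∑ j', (u (e (k, j')) - if j' = f k then a else 0) ^ 2 :=
        Finset.sum_le_univ_sum_of_nonneg fun _ => sq_nonneg _
      rw [Finset.sum_pair hj.symm] at h2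
      simp only [if_true, if_neg hj, sub_zero] at h2
      refine le_trans ?_ h2
      nlinarith [sq_nonneg (u (e (k, f k)) + u (e (k, j)) - a), mul_nonneg ha (sub_nonneg.2 hle),
        sq_nonneg (u (e (k, j)) - u (e (k, f k)))]
  calc _ ≤ ∑ k, ∑ j, (u (e (k, j)) - if j = f k then a else 0) ^ 2 :=
        Finset.sum_le_sum fun k _ => hblock k
    _ = ∑ p : κ × Fin m, (u (e p) - blockVec e a f (e p)) ^ 2 := by
        rw [Fintype.sum_prod_type]
        simp_rw [blockVec_apply]
    _ = ∑ i ∈ Finset.univ.map e, (u i - blockVec e a f i) ^ 2 := by rw [Finset.sum_map]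
    _ ≤ ∑ i, (u i - blockVec e a f i) ^ 2 :=
        Finset.sum_le_univ_sum_of_nonneg fun _ => sq_nonneg _
    _ = ‖u - blockVec e a f‖ ^ 2 := by
        rw [EuclideanSpace.norm_sq_eq]
        simp

end BlockVec

/-- The lower bound from a product prior with one entry `a` in each of `card κ` blocks of `m`
columns, when the shifts `a X_j` of the mean are weak. -/
lemma ofReal_le_sparseRegressionMinimaxRisk_of_blocks {n d s m : ℕ} {κ : Type*} [Fintype κ]
    {X : Matrix (Fin n) (Fin d) ℝ} {σ : ℝ≥0} (hσ : 0 < σ) (hm : 2 ≤ m)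
    (hs : Fintype.card κ ≤ s) (e : κ × Fin m ↪ Fin d) {a : ℝ}
    (ha0 : 0 ≤ a) (ha : ∀ p, a ^ 2 * (∑ i, X i (e p) ^ 2) / (σ : ℝ) ^ 2 ≤ Real.log m / 16) :
    ENNReal.ofReal (a ^ 2 / 8 * Fintype.card κ) ≤ sparseRegressionMinimaxRisk X σ s := by
  classical
  refine le_iInf₂ fun θhat hθ => ?_
  have : NeZero m := ⟨by omega⟩
  have hcoord (i : Fin d) : Measurable fun y => θhat y i := by fun_prop
  -- Strict maximality makes these events disjoint; ties count as failures.
  set A : κ → Fin m → Set (Fin n → ℝ) := fun k j =>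
    {y | ∀ j', j' ≠ j → θhat y (e (k, j')) < θhat y (e (k, j))} with hAdef
  have hA (k j) : MeasurableSet (A k j) := by
    simp only [hAdef, Set.ofPred_forall]
    exact MeasurableSet.iInter fun j' => MeasurableSet.iInter fun _ =>
      measurableSet_lt (hcoord _) (hcoord _)
  have hdis (k) : Pairwise (Function.onFun Disjoint (A k)) := fun j j' hjj =>
    Set.disjoint_left.2 fun y h h' => lt_asymm (h j' hjj.symm) (h' j hjj)
  obtain ⟨f, -, hf⟩ := Finset.exists_le_of_sum_le Finset.univ_nonempty
    (sum_sum_isoGaussian_real_le (V := σ ^ 2) (by positivity) hm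
      (fun k j i => a * X i (e (k, j))) (fun k j => by
        refine le_trans (le_of_eq ?_) (ha (k, j))
        simp_rw [mul_pow]
        rw [← Finset.mul_sum]
        simp) A hA hdis)
  refine le_iSup_of_le (⟨blockVec e a f, (l0_blockVec_le e a f).trans hs⟩ : SparseVec d s) ?_
  set P := isoGaussian (σ ^ 2) (∑ k, fun i => a * X i (e (k, f k))) with hP
  have hlaw : regressionLaw X σ (blockVec e a f) = P := by
    rw [hP, ← mulVec_blockVec]
    rfl
  show _ ≤ ∫⁻ y, sqL2Loss (θhat y) (blockVec e a f) ∂(regressionLaw X σ (blockVec e a f))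
  rw [hlaw]
  have hint (k : κ) : Integrable ((A k (f k))ᶜ.indicator fun _ => a ^ 2 / 2) P :=
    (integrable_const _).indicator (hA k (f k)).compl
  calc ENNReal.ofReal (a ^ 2 / 8 * Fintype.card κ)
      ≤ ENNReal.ofReal (∫ y, ∑ k, (A k (f k))ᶜ.indicator (fun _ => a ^ 2 / 2) y ∂P) := by
        refine ENNReal.ofReal_le_ofReal ?_
        rw [integral_finsetSum _ fun k _ => hint k]
        simp_rw [integral_indicator_const _ (hA _ _).compl, probReal_compl_eq_one_sub (hA _ _)]
        rw [← Finset.sum_smul, Finset.sum_sub_distrib, smul_eq_mul]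
        -- For the chosen f, the expected number of failed blocks is at least a quarter of them.
        have h : (Fintype.card κ : ℝ) / 4 ≤ ∑ _k : κ, (1 : ℝ) - ∑ k, P.real (A k (f k)) := by
          simp only [Finset.sum_const, Finset.card_univ, nsmul_eq_mul, mul_one]
          linarith
        nlinarith [mul_le_mul_of_nonneg_right h (by positivity : 0 ≤ a ^ 2 / 2)]
    _ = ∫⁻ y, ENNReal.ofReal (∑ k, (A k (f k))ᶜ.indicator (fun _ => a ^ 2 / 2) y) ∂P :=
        ofReal_integral_eq_lintegral_ofReal (integrable_finsetSum _ fun k _ => hint k)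
          (ae_of_all _ fun y => Finset.sum_nonneg fun k _ =>
            Set.indicator_nonneg (fun _ _ => by positivity) y)
    _ ≤ ∫⁻ y, sqL2Loss (θhat y) (blockVec e a f) ∂P := by
        refine lintegral_mono fun y => ENNReal.ofReal_le_ofReal ?_
        refine le_trans (le_of_eq (Finset.sum_congr rfl fun k _ => ?_))
          (sum_ite_le_sq_norm_sub_blockVec e a f ha0 (θhat y))
        by_cases h : y ∈ A k (f k)
        · rw [Set.indicator_of_notMem (by simpa using h)]
          exact (if_pos h).symm
        · rw [Set.indicator_of_mem (by simpa using h)]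
          exact (if_neg h).symm

/-! ### Selecting short columns and tuning the constants. -/

lemma frobenius_norm_sq_eq_sum {n d : ℕ} (X : Matrix (Fin n) (Fin d) ℝ) :
    ‖X‖ ^ 2 = ∑ j, ∑ i, X i j ^ 2 := by
  rw [Matrix.frobenius_norm_def, ← Real.sqrt_eq_rpow, Real.sq_sqrt (by positivity),
    Finset.sum_comm]
  simp

/-- Fewer than a quarter of the terms of a sum exceed four times the average. -/
lemma three_mul_lt_four_mul_card_filter_le {d : ℕ} (hd : 0 < d) {q : Fin d → ℝ}
    (hq : ∀ j, 0 ≤ q j) (hpos : 0 < ∑ j, q j) :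
    3 * d < 4 * (Finset.univ.filter fun j => q j ≤ 4 * (∑ i, q i) / d).card := by
  set S := ∑ i, q i
  have hsplit := Finset.card_filter_add_card_filter_not (s := Finset.univ)
    fun j => q j ≤ 4 * S / d
  rw [Finset.card_univ, Fintype.card_fin] at hsplit
  set B := Finset.univ.filter fun j => ¬ q j ≤ 4 * S / d
  have hd' : (0 : ℝ) < d := by exact_mod_cast hd
  have hbad : 4 * B.card < d := by
    rcases B.eq_empty_or_nonempty with h | h
    · simpa [h] using hd
    · have h1 : ∑ _j ∈ B, 4 * S / d < ∑ j ∈ B, q j :=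
        Finset.sum_lt_sum_of_nonempty h fun j hj => not_le.1 (Finset.mem_filter.1 hj).2
      have h2 : ∑ j ∈ B, q j ≤ S := Finset.sum_le_univ_sum_of_nonneg hq
      rw [Finset.sum_const, nsmul_eq_mul] at h1
      have h3 := h1.trans_le h2
      have h4 : (B.card : ℝ) * (4 * S / d) = (4 * B.card / d) * S := by ring
      rw [h4] at h3
      have h5 : 4 * (B.card : ℝ) / d < 1 := by
        by_contra hc
        push Not at hc
        nlinarith
      rw [div_lt_one hd'] at h5
      exact_mod_cast h5
  omega

theorem corollary4 :
    ∃ c : ℝ, 0 < c ∧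
      ∀ (n d s : ℕ) (σ : ℝ≥0) (X : Matrix (Fin n) (Fin d) ℝ),
        0 < σ → 1 ≤ s → s ≤ d → X ≠ 0 →
          ENNReal.ofReal
              (c * ((σ : ℝ) ^ 2 * (s : ℝ) * (d : ℝ) * Real.log ((d : ℝ) / (s : ℝ))) / ‖X‖ ^ 2) ≤
            sparseRegressionMinimaxRisk X σ s := by
  -- 3072 = 3 · 2 · 64 · 8, from s ≤ 3r, log(d/s) ≤ 2 log m, the 64 in b, and the risk a²r/8.
  refine ⟨1 / 3072, by norm_num, fun n d s σ X hσ hs hsd hX => ?_⟩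
  have hd0 : (0 : ℝ) < d := by exact_mod_cast hs.trans hsd
  have hs0 : (0 : ℝ) < s := by exact_mod_cast hs
  have hσ' : (0 : ℝ) < σ := by exact_mod_cast hσ
  rcases hsd.eq_or_lt with rfl | hlt
  · simp [div_self hs0.ne']
  have hN : 0 < ‖X‖ ^ 2 := by have := norm_pos_iff.2 hX; positivity
  have hG := three_mul_lt_four_mul_card_filter_le (d := d) (by omega)
    (q := fun j => ∑ i, X i j ^ 2) (fun j => Finset.sum_nonneg fun _ _ => sq_nonneg _)
    (by rwa [← frobenius_norm_sq_eq_sum])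
  rw [← frobenius_norm_sq_eq_sum] at hG
  set G := Finset.univ.filter fun j => ∑ i, X i j ^ 2 ≤ 4 * ‖X‖ ^ 2 / d
  -- r = ⌈s/3⌉ rather than s leaves at least two good columns per block even when s is close to d.
  set r := (s + 2) / 3 with hr
  set m := G.card / r
  have hr0 : 0 < r := by omega
  have hrs : r ≤ s := by omega
  have hm : 2 ≤ m := (Nat.le_div_iff_mul_le hr0).2 (by omega)
  have hrm : r * m ≤ G.card := Nat.mul_div_le _ _
  have hGlt : G.card < r * (m + 1) := Nat.lt_mul_div_succ _ hr0
  obtain ⟨e⟩ : Nonempty (Fin r × Fin m ↪ G) :=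
    Function.Embedding.nonempty_of_card_le (by simpa using hrm)
  have hmR : (2 : ℝ) ≤ m := by exact_mod_cast hm
  have hlogm : 0 ≤ Real.log m := Real.log_nonneg (by linarith)
  have hsr : (s : ℝ) ≤ 3 * r := by
    have : s ≤ 3 * r := by omega
    exact_mod_cast this
  -- d/s ≤ 4(m + 1)/3 ≤ m², the last step being an equality at m = 2.
  have hlog : Real.log (d / s) ≤ 2 * Real.log m := by
    rw [show (2 : ℝ) * Real.log m = Real.log ((m : ℝ) ^ 2) by rw [Real.log_pow]; norm_num]
    refine Real.log_le_log (by positivity) ((div_le_iff₀ hs0).2 ?_)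
    have h1 : 3 * d ≤ 4 * (s * (m + 1)) :=
      hG.le.trans (Nat.mul_le_mul_left 4 (hGlt.le.trans (Nat.mul_le_mul_right _ hrs)))
    have h1' : 3 * (d : ℝ) ≤ 4 * (s * (m + 1)) := by exact_mod_cast h1
    nlinarith [mul_nonneg hs0.le (by nlinarith : 0 ≤ 3 * (m : ℝ) ^ 2 - 4 * (m + 1))]
  -- b is the value of a² at which a column of squared norm 4‖X‖²/d meets the limit log m / 16
  -- exactly.
  set b : ℝ := (σ : ℝ) ^ 2 * Real.log m * d / (64 * ‖X‖ ^ 2) with hb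
  have hb0 : 0 ≤ b := by positivity
  have hrisk := ofReal_le_sparseRegressionMinimaxRisk_of_blocks (X := X) (s := s) hσ hm
    (by simpa using hrs) (e.trans (Function.Embedding.subtype _)) (Real.sqrt_nonneg b) (fun p => by
      have hp : ∑ i, X i (e p) ^ 2 ≤ 4 * ‖X‖ ^ 2 / d := (Finset.mem_filter.1 (e p).2).2
      rw [Real.sq_sqrt hb0]
      calc b * (∑ i, X i (e p) ^ 2) / (σ : ℝ) ^ 2 ≤ b * (4 * ‖X‖ ^ 2 / d) / (σ : ℝ) ^ 2 := by
            gcongr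
        _ = Real.log m / 16 := by
            rw [hb]
            field_simp
            ring)
  refine le_trans (ENNReal.ofReal_le_ofReal ?_) hrisk
  rw [Real.sq_sqrt hb0, Fintype.card_fin]
  calc 1 / 3072 * ((σ : ℝ) ^ 2 * s * d * Real.log (d / s)) / ‖X‖ ^ 2
      ≤ 1 / 3072 * ((σ : ℝ) ^ 2 * (3 * r) * d * (2 * Real.log m)) / ‖X‖ ^ 2 := by
        have : 0 ≤ Real.log (d / s) := Real.log_nonneg ((one_le_div hs0).2 (by exact_mod_cast hsd))
        gcongr
    _ = b / 8 * r := by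
        rw [hb]
        field_simp
        ring
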